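/- **Setting.** There are $m\ge 1$ machines. A job $j$ has a size $p_j>0$ and a nonempty set $N(j)\subseteq[m]$ of machines on which it may be processed; an $n$-job restricted assignment instance $S$ is a sequence of $n$ jobs. A fractional assignment is a family $x_{ij}\ge 0$ with $x_{ij}=0$ for $i\notin N(j)$ and $\sum_i x_{ij}=1$ for every $j$; its makespan is $\max_i\sum_j p_jx_{ij}$. Let $\mathrm{OPT}(S)$ be the minimum makespan of a fractional assignment. For positive weights $w=(w_i)_{i\in[m]}$ let $\mathrm{ALG}(S,w)$ be the makespan of the assignment $x_{ij}(w)=w_i/\sum_{i'\in N(j)}w_{i'}$ for $i\in N(j)$, and $x_{ij}(w)=0$ otherwise. For $\epsilon>0$ and an integer $R\ge 0$ let $\mathcal W(R)=\{w\in\mathbb R^m : \text{for every } i,\ w_i=(1+\epsilon)^{k}\text{ for some }k\in\{0,1,\dots,R\}\}$. **Theorem.** There are absolute constants $C_0,C_1,C_2>0$ such that the following holds. Let $m\ge 1$ and $n\ge 0$ be integers, let $\epsilon,\delta\in(0,1)$, put $R=\big\lceil C_1\frac{m^2}{\epsilon^2}\log\frac m\epsilon\big\rceil$, and let $s$ be an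 integer with $$s\ \ge\ C_2\,\frac{m^3}{\epsilon^2}\,\log\frac 2\delta\,\log\frac m\epsilon ,$$ so that $s=\tilde O\big(\frac{m^3}{\epsilon^2}\log\frac1\delta\big)$ samples suffice. There is a learning algorithm (a measurable map from $s$-tuples of $n$-job instances to $\mathcal W(R)$) with the following property. Let $p_{\max}>0$, and let $\mathcal D=\prod_{j=1}^n\mathcal D_j$ be any product distribution over $n$-job instances (the jobs, i.e. the pairs of size and neighbourhood, are independent) with all job sizes at most $p_{\max}$ almost surely and $$\mathbb E_{S\sim\mathcal D}[\mathrm{OPT}(S)]\ \ge\ C_0\,\frac{p_{\max}}{\epsilon^2}\log\frac m\epsilon .$$ Then, with probability at least $1-\delta$ over $s$ independent samples $S_1,\dots,S_s\sim\mathcal D$, the weights $w\in\mathcal W(R)$ that the algorithm outputs on $(S_1,\dots,S_s)$ satisfy $$\mathbb E_{S\sim\mathcal D}[\mathrm{ALG}(S,w)]\le(1+\epsilon)\,\mathbb E_{S\sim\mathcal D}[\mathrm{OPT}(S)]$$ and in particular $\mathbb E_{S\sim\mathcal D}[\mathrm{ALG}(S,w)]\le(1+\epsilon)\min_{w'\in\mathcal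 W(R)}\mathbb E_{S\sim\mathcal D}[\mathrm{ALG}(S,w')]$. -/

import Mathlib

open MeasureTheory

noncomputable section

/-- A job of the restricted assignment problem on the machines `Fin m`: a positive size together
with the nonempty set of machines on which the job may be processed. -/
structure Job (m : ℕ) where
  size : ℝ
  nbhd : Finset (Fin m)
  size_pos : 0 < size
  nbhd_nonempty : nbhd.Nonempty

/-- Borel on the sizes, discrete on the (finitely many) neighbourhoods. -/
instance Job.instMeasurableSpace (m : ℕ) : MeasurableSpace (Job m) :=
  MeasurableSpace.comap Job.size (borel ℝ) ⊔ MeasurableSpace.comap Job.nbhd ⊤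

/-- An `n`-job restricted assignment instance on `m` machines. -/
abbrev JobInstance (m n : ℕ) : Type := Fin n → Job m

/-- `x i j` is the fraction of job `j` that is processed on machine `i`. -/
structure IsFractionalAssignment {m n : ℕ} (S : JobInstance m n) (x : Fin m → Fin n → ℝ) :
    Prop where
  nonneg : ∀ i j, 0 ≤ x i j
  support : ∀ i j, i ∉ (S j).nbhd → x i j = 0
  sum_eq_one : ∀ j, ∑ i, x i j = 1

/-- The load of machine `i` under the fractional assignment `x`. -/
def load {m n : ℕ} (S : JobInstance m n) (x : Fin m → Fin n → ℝ) (i : Fin m) : ℝ :=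
  ∑ j, (S j).size * x i j

/-- The fractional makespan: the maximum load of a machine. -/
def makespan {m n : ℕ} (S : JobInstance m n) (x : Fin m → Fin n → ℝ) : ℝ :=
  ⨆ i, load S x i

/-- The optimal fractional makespan. -/
def opt {m n : ℕ} (S : JobInstance m n) : ℝ :=
  sInf {T | ∃ x, IsFractionalAssignment S x ∧ makespan S x = T}

/-- The proportional assignment with machine weights `w`. -/
def propAssign {m n : ℕ} (S : JobInstance m n) (w : Fin m → ℝ) (i : Fin m) (j : Fin n) : ℝ :=
  if i ∈ (S j).nbhd then w i / ∑ i' ∈ (S j).nbhd, w i' else 0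

/-- The fractional makespan of the proportional assignment with machine weights `w`. -/
def alg {m n : ℕ} (S : JobInstance m n) (w : Fin m → ℝ) : ℝ :=
  makespan S (propAssign S w)

/-- The discretised weights `W(R)`: every coordinate is `(1 + ε) ^ k` with `k ∈ {0, …, R}`. -/
def weightGrid (m : ℕ) (ε : ℝ) (R : ℕ) : Set (Fin m → ℝ) :=
  {w | ∀ i, ∃ k : ℕ, k ≤ R ∧ w i = (1 + ε) ^ k}

/-- The exponent bound `R = ⌈C (m² / ε²) log (m / ε)⌉`. -/
def roundBound (C : ℝ) (m : ℕ) (ε : ℝ) : ℕ :=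
  ⌈C * ((m : ℝ) ^ 2 / ε ^ 2 * Real.log (m / ε))⌉₊

end

/-! Write T for the expected optimum. The learner never estimates a makespan: over the weight grid
it minimises the largest total load that a machine receives across all samples. Three facts make
this enough.

Good grid weights exist (`exists_grid_weights_load_le`). Jobs confined to a machine set A have total
size at most |A| times the optimum; this Hall condition is linear, so the expected volumes satisfy
it with T. Start from equal weights and repeatedly divide by 1 + ε the weight of a machine with load
above (1 + 9ε/16)T. If some weight dropped too far, a long gap in the exponents would separate a set
A of light machines. Each machine of A was overloaded just before its last decrease, and
`laggedShare` bounds its shares at that moment by the present weights. These bounds sum to at most 1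
+ ε/2 for each job, so the jobs confined to A account for at most (1 + ε/2)|A|T, while the gap keeps
all other jobs from adding more than (ε/16)|A|T. This contradicts the overloads, so the process
stops inside the grid.

Mean loads are learnable. The load of a machine over all samples is a sum of independent terms in
[0, pmax]. As T is large compared with pmax, a relative deviation of order ε has probability at most
exp(-s log(m/ε)), small enough for a union bound over the grid.

Mean loads control the makespan (`integral_iSup_le_of_mgf`). The expected maximum of m such loads
exceeds the largest mean only by a factor 1 + e and a term pmax log m / e, which T absorbs. -/

noncomputable section

/-! ### Balancing volumes by decreasing weights on a geometric grid -/

/-- The fraction of a job with neighbourhood `N` that the weights `w` send to machine `i`. -/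
def share {m : ℕ} (w : Fin m → ℝ) (i : Fin m) (N : Finset (Fin m)) : ℝ :=
  if i ∈ N then w i / ∑ i' ∈ N, w i' else 0

/-- The share of machine `i` for the weights `(1 + ε) ^ (-c)` at the moment before the last
decrease of its weight, bounded in terms of the current weights: the machines of rank at least
`r i` have been decreased since. -/
def laggedShare {m : ℕ} (ε : ℝ) (c r : Fin m → ℕ) (i : Fin m) (N : Finset (Fin m)) : ℝ :=
  if i ∈ N then
    (1 + ε) * ((1 + ε)⁻¹ ^ c i) /
      ∑ i' ∈ N, (1 + ε)⁻¹ ^ c i' * (if r i ≤ r i' then 1 + ε else 1)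
  else 0

/-- Every machine whose weight was ever decreased had a large load before its last decrease. -/
def IsDecreaseHistory {m : ℕ} (v : Finset (Fin m) → ℝ) (ε B : ℝ) (c r : Fin m → ℕ) : Prop :=
  ∀ i, 0 < c i → B < ∑ N, v N * laggedShare ε c r i N

/-- Any two elements are comparable in rank, so each product is counted in at least one of the two
orders. -/
lemma half_le_sum_mul_sum_rank {ι : Type*} (N : Finset ι) (a : ι → ℝ) (ha : ∀ i ∈ N, 0 ≤ a i)
    (r : ι → ℕ) :
    (∑ i ∈ N, a i) ^ 2 / 2 ≤ ∑ i ∈ N, ∑ i' ∈ N, a i * (a i' * if r i ≤ r i' then 1 else 0) := by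
  have hswap : ∑ i ∈ N, ∑ i' ∈ N, a i * (a i' * if r i ≤ r i' then (1 : ℝ) else 0)
      = ∑ i ∈ N, ∑ i' ∈ N, a i * (a i' * if r i' ≤ r i then (1 : ℝ) else 0) := by
    rw [Finset.sum_comm]
    refine Finset.sum_congr rfl fun i _ => Finset.sum_congr rfl fun i' _ => by ring
  have hsum : (∑ i ∈ N, a i) ^ 2
      ≤ ∑ i ∈ N, ∑ i' ∈ N, a i * (a i' * if r i ≤ r i' then (1 : ℝ) else 0)
        + ∑ i ∈ N, ∑ i' ∈ N, a i * (a i' * if r i' ≤ r i then (1 : ℝ) else 0) := by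
    rw [sq, Finset.sum_mul_sum, ← Finset.sum_add_distrib]
    refine Finset.sum_le_sum fun i hi => ?_
    rw [← Finset.sum_add_distrib]
    refine Finset.sum_le_sum fun i' hi' => ?_
    have h := mul_nonneg (ha i hi) (ha i' hi')
    rcases le_total (r i) (r i') with h1 | h1
    · rw [if_pos h1]
      split_ifs <;> nlinarith
    · rw [if_pos h1]
      split_ifs <;> nlinarith
  linarith

/-- The denominator is W + εU with U between 0 and W. By convexity its reciprocal lies below the
chord in U, and the rank lemma says that the weighted average of U is at least W/2. This saves half
of the ε that one grid step could cost. -/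
lemma sum_lagged_ratio_le {ι : Type*} (N : Finset ι) (hN : N.Nonempty) (a : ι → ℝ)
    (ha : ∀ i, 0 < a i) (r : ι → ℕ) {ε : ℝ} (hε : 0 < ε) :
    ∑ i ∈ N, (1 + ε) * a i / ∑ i' ∈ N, a i' * (if r i ≤ r i' then 1 + ε else 1) ≤ 1 + ε / 2 := by
  set W := ∑ i ∈ N, a i with hW
  have hWpos : 0 < W := Finset.sum_pos (fun i _ => ha i) hN
  set U : ι → ℝ := fun i => ∑ i' ∈ N, a i' * (if r i ≤ r i' then (1 : ℝ) else 0) with hU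
  have hUnonneg : ∀ i, 0 ≤ U i := fun i => Finset.sum_nonneg fun i' _ => by
    have := ha i'
    split_ifs <;> simp [this.le]
  have hUle : ∀ i, U i ≤ W := fun i => Finset.sum_le_sum fun i' _ => by
    have := ha i'
    split_ifs <;> simp [this.le]
  have hden : ∀ i, ∑ i' ∈ N, a i' * (if r i ≤ r i' then 1 + ε else 1) = W + ε * U i := by
    intro i
    rw [hW, hU, Finset.mul_sum, ← Finset.sum_add_distrib]
    refine Finset.sum_congr rfl fun i' _ => ?_
    split_ifs <;> ring
  have hchord : ∀ i ∈ N, (1 + ε) * a i / ∑ i' ∈ N, a i' * (if r i ≤ r i' then 1 + ε else 1)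
      ≤ (1 + ε) / W * a i - ε / W ^ 2 * (a i * U i) := by
    intro i _
    rw [hden, div_le_iff₀ (by nlinarith [hUnonneg i])]
    have h1 : ((1 + ε) / W * a i - ε / W ^ 2 * (a i * U i)) * (W + ε * U i)
        = (1 + ε) * a i + a i * (ε ^ 2 / W ^ 2) * (U i * (W - U i)) := by
      field_simp
      ring
    rw [h1]
    have : 0 ≤ a i * (ε ^ 2 / W ^ 2) * (U i * (W - U i)) :=
      mul_nonneg (mul_nonneg (ha i).le (by positivity))
        (mul_nonneg (hUnonneg i) (sub_nonneg.2 (hUle i)))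
    linarith
  refine (Finset.sum_le_sum hchord).trans ?_
  rw [Finset.sum_sub_distrib, ← Finset.mul_sum, ← Finset.mul_sum, ← hW]
  have hhalf : W ^ 2 / 2 ≤ ∑ i ∈ N, a i * U i := by
    have := half_le_sum_mul_sum_rank N a (fun i _ => (ha i).le) r
    simpa only [hU, Finset.mul_sum] using this
  have h2 : ε / W ^ 2 * (W ^ 2 / 2) ≤ ε / W ^ 2 * ∑ i ∈ N, a i * U i :=
    mul_le_mul_of_nonneg_left hhalf (by positivity)
  have h3 : ε / W ^ 2 * (W ^ 2 / 2) = ε / 2 := by field_simp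
  have h4 : (1 + ε) / W * W = 1 + ε := by field_simp
  linarith

lemma sum_laggedShare_le {m : ℕ} {ε : ℝ} (hε : 0 < ε) (c r : Fin m → ℕ)
    {A N : Finset (Fin m)} (hNA : N ⊆ A) : ∑ i ∈ A, laggedShare ε c r i N ≤ 1 + ε / 2 := by
  have h : ∑ i ∈ A, laggedShare ε c r i N = ∑ i ∈ N, laggedShare ε c r i N := by
    refine (Finset.sum_subset hNA fun i _ hi => ?_).symm
    simp [laggedShare, hi]
  rw [h]
  rcases N.eq_empty_or_nonempty with rfl | hN
  · simp; positivity
  · refine le_trans (le_of_eq ?_)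
      (sum_lagged_ratio_le N hN (fun i => (1 + ε)⁻¹ ^ c i) (fun i => by positivity) r hε)
    refine Finset.sum_congr rfl fun i hi => ?_
    simp [laggedShare, hi]

/-- One much heavier machine in the neighbourhood already dominates the denominator; the extra 1 in
the gap pays for the factor 1 + ε in the numerator. -/
lemma laggedShare_le_of_gap {m : ℕ} {ε : ℝ} (hε : 0 < ε) (c r : Fin m → ℕ) {i i' : Fin m}
    {N : Finset (Fin m)} (hi' : i' ∈ N) {G : ℕ} (hgap : c i' + G + 1 ≤ c i) :
    laggedShare ε c r i N ≤ (1 + ε)⁻¹ ^ G := by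
  have h1 : (0 : ℝ) < 1 + ε := by positivity
  unfold laggedShare
  split_ifs with hi
  · have hterm : ∀ l, (1 + ε)⁻¹ ^ c l ≤ (1 + ε)⁻¹ ^ c l * (if r i ≤ r l then 1 + ε else 1) := by
      intro l
      refine le_mul_of_one_le_right (by positivity) ?_
      split_ifs <;> linarith
    have hden : (1 + ε)⁻¹ ^ c i' ≤
        ∑ l ∈ N, (1 + ε)⁻¹ ^ c l * (if r i ≤ r l then 1 + ε else 1) :=
      (hterm i').trans (Finset.single_le_sum
        (f := fun l => (1 + ε)⁻¹ ^ c l * (if r i ≤ r l then 1 + ε else 1))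
        (fun l _ => le_trans (by positivity) (hterm l)) hi')
    have hpos : 0 < (1 + ε)⁻¹ ^ c i' := by positivity
    rw [div_le_iff₀ (hpos.trans_le hden)]
    refine le_trans ?_ (mul_le_mul_of_nonneg_left hden (by positivity))
    have hle : (1 + ε)⁻¹ ^ c i ≤ (1 + ε)⁻¹ ^ (c i' + G + 1) :=
      pow_le_pow_of_le_one (by positivity) (inv_le_one_of_one_le₀ (by linarith)) hgap
    calc (1 + ε) * (1 + ε)⁻¹ ^ c i ≤ (1 + ε) * (1 + ε)⁻¹ ^ (c i' + G + 1) :=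
          mul_le_mul_of_nonneg_left hle h1.le
      _ = (1 + ε)⁻¹ ^ G * (1 + ε)⁻¹ ^ c i' := by
          rw [pow_succ, pow_add]
          field_simp
  · positivity

/-- Pigeonhole: `i₀` lies above all m blocks, so only m - 1 machines are left to occupy them. -/
lemma exists_empty_block {m : ℕ} (c : Fin m → ℕ) (G : ℕ) (i₀ : Fin m) (h : m * G < c i₀) :
    ∃ q < m, ∀ i, c i ≤ q * G ∨ (q + 1) * G < c i := by
  have : Nonempty (Fin m) := ⟨i₀⟩
  by_contra! hcon
  choose! f hf using hcon
  have hinj : Set.InjOn f (Finset.range m : Set ℕ) := by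
    intro q hq q' hq' he
    simp only [Finset.coe_range, Set.mem_Iio] at hq hq'
    have h1 := hf q hq
    have h2 := hf q' hq'
    rw [← he] at h2
    rcases lt_trichotomy q q' with hlt | heq | hlt
    · have : (q + 1) * G ≤ q' * G := Nat.mul_le_mul_right G hlt
      omega
    · exact heq
    · have : (q' + 1) * G ≤ q * G := Nat.mul_le_mul_right G hlt
      omega
  have hmaps : ∀ q ∈ Finset.range m, f q ∈ (Finset.univ.erase i₀ : Finset (Fin m)) := by
    intro q hq
    rw [Finset.mem_range] at hq
    refine Finset.mem_erase.2 ⟨fun he => ?_, Finset.mem_univ _⟩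
    have h1 := (hf q hq).2
    rw [he] at h1
    have : (q + 1) * G ≤ m * G := Nat.mul_le_mul_right G hq
    omega
  have hcard := Finset.card_le_card_of_injOn f hmaps hinj
  rw [Finset.card_range, Finset.card_erase_of_mem (Finset.mem_univ _), Finset.card_univ,
    Fintype.card_fin] at hcard
  have := i₀.pos
  omega

/-- Sum the overloads over the machines above an empty block. The threshold 9/16 is 1/2 for the jobs
confined to these machines plus 1/16 for the leak of all other jobs. -/
lemma IsDecreaseHistory.count_le {m : ℕ} {v : Finset (Fin m) → ℝ} (hv : ∀ N, 0 ≤ v N) {T ε : ℝ}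
    (hε : 0 < ε) (hall : ∀ A : Finset (Fin m), ∑ N ∈ A.powerset, v N ≤ A.card * T) {G : ℕ}
    (hG : m ≤ ε / 16 * (1 + ε) ^ G) {c r : Fin m → ℕ}
    (h : IsDecreaseHistory v ε ((1 + 9 / 16 * ε) * T) c r) (i : Fin m) : c i ≤ m * G := by
  by_contra! hi
  obtain ⟨q, hqm, hq⟩ := exists_empty_block c G i hi
  set A : Finset (Fin m) := Finset.univ.filter fun i => (q + 1) * G < c i with hA
  have hiA : A.Nonempty := by
    refine ⟨i, Finset.mem_filter.2 ⟨Finset.mem_univ i, lt_of_le_of_lt ?_ hi⟩⟩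
    exact Nat.mul_le_mul_right G hqm
  have hT : 0 ≤ T := by
    have h1 := hall Finset.univ
    have h2 : 0 ≤ ∑ N ∈ (Finset.univ : Finset (Fin m)).powerset, v N :=
      Finset.sum_nonneg fun N _ => hv N
    have h3 : (0 : ℝ) < (Finset.univ : Finset (Fin m)).card := by
      simpa using i.pos
    nlinarith
  have hV : ∑ N, v N ≤ m * T := by simpa using hall Finset.univ
  have hleak : ((1 + ε)⁻¹ ^ G) * m ≤ ε / 16 := by
    rw [inv_pow, inv_mul_le_iff₀ (by positivity)]
    linarith
  have hlow : A.card * ((1 + 9 / 16 * ε) * T) < ∑ i ∈ A, ∑ N, v N * laggedShare ε c r i N := by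
    rw [← nsmul_eq_mul, ← Finset.sum_const]
    refine Finset.sum_lt_sum_of_nonempty hiA fun i hi => h i ?_
    exact (Nat.zero_le _).trans_lt (Finset.mem_filter.1 hi).2
  have hup : ∑ i ∈ A, ∑ N, v N * laggedShare ε c r i N
      ≤ ∑ N, ((if N ∈ A.powerset then v N * (1 + ε / 2) else 0)
          + v N * (A.card * (1 + ε)⁻¹ ^ G)) := by
    rw [Finset.sum_comm]
    refine Finset.sum_le_sum fun N _ => ?_
    rw [← Finset.mul_sum]
    have hpos : 0 ≤ v N * (A.card * (1 + ε)⁻¹ ^ G) := mul_nonneg (hv N) (by positivity)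
    split_ifs with hN
    · have := mul_le_mul_of_nonneg_left
        (sum_laggedShare_le hε c r (Finset.mem_powerset.1 hN)) (hv N)
      linarith
    · rw [zero_add]
      refine mul_le_mul_of_nonneg_left ?_ (hv N)
      rw [← nsmul_eq_mul]
      refine Finset.sum_le_card_nsmul _ _ _ fun l hl => ?_
      rw [Finset.mem_powerset, Finset.not_subset] at hN
      obtain ⟨i', hi'N, hi'A⟩ := hN
      refine laggedShare_le_of_gap hε c r hi'N ?_
      have h1 := (Finset.mem_filter.1 hl).2
      have h2 : ¬ (q + 1) * G < c i' := fun hc =>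
        hi'A (Finset.mem_filter.2 ⟨Finset.mem_univ _, hc⟩)
      have h3 := (hq i').resolve_right h2
      have h4 : (q + 1) * G = q * G + G := by ring
      omega
  rw [Finset.sum_add_distrib, ← Finset.sum_filter, ← Finset.sum_mul, ← Finset.sum_mul] at hup
  have hfil : (Finset.univ.filter fun N => N ∈ A.powerset) = A.powerset := by ext; simp
  rw [hfil] at hup
  have h1 : (∑ N ∈ A.powerset, v N) * (1 + ε / 2) ≤ A.card * T * (1 + ε / 2) :=
    mul_le_mul_of_nonneg_right (hall A) (by positivity)
  have h2 : (∑ N, v N) * (A.card * (1 + ε)⁻¹ ^ G) ≤ m * T * (A.card * (1 + ε)⁻¹ ^ G) :=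
    mul_le_mul_of_nonneg_right hV (by positivity)
  have h3 : (A.card * T) * ((1 + ε)⁻¹ ^ G * m) ≤ (A.card * T) * (ε / 16) :=
    mul_le_mul_of_nonneg_left hleak (by positivity)
  nlinarith

lemma IsDecreaseHistory.step {m : ℕ} {v : Finset (Fin m) → ℝ} (hv : ∀ N, 0 ≤ v N) {B ε : ℝ}
    (hε : 0 < ε) {c r : Fin m → ℕ} (h : IsDecreaseHistory v ε B c r) (i : Fin m)
    (hi : B < ∑ N, v N * share (fun l => (1 + ε)⁻¹ ^ c l) i N) :
    ∃ r', IsDecreaseHistory v ε B (Function.update c i (c i + 1)) r' := by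
  have h1 : (0 : ℝ) < 1 + ε := by positivity
  have hw : (1 + ε) * (1 + ε)⁻¹ ^ (c i + 1) = (1 + ε)⁻¹ ^ c i := by
    rw [pow_succ]
    field_simp
  have hr : ∀ l, r l < Finset.univ.sup r + 1 := fun l =>
    Nat.lt_succ_of_le (Finset.le_sup (Finset.mem_univ l))
  -- Ranks order the machines by their last decrease, so the machine just decreased gets a rank
  -- above all others.
  refine ⟨Function.update r i (Finset.univ.sup r + 1), fun l hl => ?_⟩
  rcases eq_or_ne l i with rfl | hli
  · refine hi.trans_le (le_of_eq (Finset.sum_congr rfl fun N _ => ?_))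
    congr 1
    unfold share laggedShare
    split_ifs with hN
    · simp only [Function.update_self]
      rw [hw]
      congr 1
      refine Finset.sum_congr rfl fun l' _ => ?_
      rcases eq_or_ne l' l with rfl | hne
      · simp only [Function.update_self, le_refl, if_true]
        rw [mul_comm, hw]
      · simp only [Function.update_of_ne hne]
        rw [if_neg (not_le.2 (hr l')), mul_one]
    · rfl
  · rw [Function.update_of_ne hli] at hl
    refine (h l hl).trans_le (Finset.sum_le_sum fun N _ => mul_le_mul_of_nonneg_left ?_ (hv N))
    unfold laggedShare
    split_ifs with hN
    · simp only [Function.update_of_ne hli]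
      have hfac : ∀ P : Prop, ∀ [Decidable P], (1 : ℝ) ≤ if P then 1 + ε else 1 := by
        intro P _
        split_ifs <;> linarith
      refine div_le_div_of_nonneg_left (by positivity) ?_ (Finset.sum_le_sum fun l' _ => ?_)
      · refine Finset.sum_pos (fun l' _ => mul_pos (by positivity) ?_) ⟨l, hN⟩
        exact zero_lt_one.trans_le (hfac _)
      -- The new factor 1 + ε of machine `i` exactly undoes its decrease, so earlier overload bounds
      -- survive.
      · rcases eq_or_ne l' i with rfl | hne
        · simp only [Function.update_self]
          rw [if_pos (hr l).le, mul_comm, hw]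
          exact le_mul_of_one_le_right (by positivity) (hfac _)
        · simp only [Function.update_of_ne hne, le_refl]
    · exact le_rfl

lemma share_smul {m : ℕ} {a : ℝ} (ha : a ≠ 0) (w : Fin m → ℝ) (i : Fin m)
    (N : Finset (Fin m)) : share (fun l => a * w l) i N = share w i N := by
  unfold share
  rw [← Finset.mul_sum, mul_div_mul_left _ _ ha]

/-- Proportional weights from a geometric grid that balance the loads, for job volumes satisfying
Hall's condition: the grid ratio `1 + ε` costs only slightly more than a factor `1 + ε / 2`. -/
theorem exists_grid_weights_load_le {m : ℕ} {v : Finset (Fin m) → ℝ} (hv : ∀ N, 0 ≤ v N)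
    {T ε : ℝ} (hε : 0 < ε) (hall : ∀ A : Finset (Fin m), ∑ N ∈ A.powerset, v N ≤ A.card * T)
    {G : ℕ} (hG : m ≤ ε / 16 * (1 + ε) ^ G) :
    ∃ k : Fin m → ℕ, (∀ i, k i ≤ m * G) ∧
      ∀ i, ∑ N, v N * share (fun l => (1 + ε) ^ k l) i N ≤ (1 + 9 / 16 * ε) * T := by
  have h1 : (0 : ℝ) < 1 + ε := by positivity
  suffices H : ∃ c r : Fin m → ℕ, IsDecreaseHistory v ε ((1 + 9 / 16 * ε) * T) c r ∧
      ∀ i, ∑ N, v N * share (fun l => (1 + ε)⁻¹ ^ c l) i N ≤ (1 + 9 / 16 * ε) * T by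
    obtain ⟨c, r, hcr, hstable⟩ := H
    have hc := hcr.count_le hv hε hall hG
    -- Rescaling all weights by (1 + ε)^(mG) keeps the shares and makes the exponents nonnegative.
    refine ⟨fun i => m * G - c i, fun i => Nat.sub_le _ _, fun i => ?_⟩
    have hk : (fun l => (1 + ε) ^ (m * G - c l))
        = fun l => (1 + ε) ^ (m * G) * (1 + ε)⁻¹ ^ c l := by
      funext l
      rw [inv_pow, pow_sub₀ _ h1.ne' (hc l)]
    simp only [hk, share_smul (pow_pos h1 (m * G)).ne']
    exact hstable i
  -- If the process never stopped, the total number of decreases would exceed the bound m · mG.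
  by_contra! hcon
  have hex : ∀ t : ℕ, ∃ c r : Fin m → ℕ,
      IsDecreaseHistory v ε ((1 + 9 / 16 * ε) * T) c r ∧ ∑ i, c i = t := by
    intro t
    induction t with
    | zero => exact ⟨0, 0, fun i hi => absurd hi (by simp), by simp⟩
    | succ t ih =>
      obtain ⟨c, r, hcr, hsum⟩ := ih
      obtain ⟨i, hi⟩ := hcon c r hcr
      obtain ⟨r', hr'⟩ := hcr.step hv hε i hi
      refine ⟨_, r', hr', ?_⟩
      rw [Finset.sum_update_of_mem (Finset.mem_univ i), ← hsum,
        ← Finset.add_sum_erase _ _ (Finset.mem_univ i), Finset.sdiff_singleton_eq_erase]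
      ring
  obtain ⟨c, r, hcr, hsum⟩ := hex (m * (m * G) + 1)
  have hle : ∑ i, c i ≤ m * (m * G) := by
    have := Finset.sum_le_card_nsmul Finset.univ c (m * G)
      fun i _ => hcr.count_le hv hε hall hG i
    simpa using this
  omega

/-! ### Chernoff bounds, expected maxima and measurable minimisers -/

section Tails

variable {Ω : Type*} [MeasurableSpace Ω]

/-- The exponential moments of a sum of independent variables with values in `[0, b]` and total
mean `M`. -/
structure HasBoundedSumMGF (P : Measure Ω) (F : Ω → ℝ) (b M : ℝ) : Prop where
  integrable : ∀ t, Integrable (fun x => Real.exp (t * F x)) P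
  le : ∀ t, |t * b| ≤ 1 → ∫ x, Real.exp (t * F x) ∂P ≤ Real.exp (M * (t + t ^ 2 * b))

/-- Convexity on [0, b], then exp y ≤ 1 + y + y² for |y| ≤ 1. -/
lemma exp_mul_le_chord {b x t : ℝ} (hb : 0 < b) (hx0 : 0 ≤ x) (hxb : x ≤ b) (ht : |t * b| ≤ 1) :
    Real.exp (t * x) ≤ 1 + (t + t ^ 2 * b) * x := by
  have ha0 : 0 ≤ x / b := by positivity
  have ha1 : x / b ≤ 1 := (div_le_one hb).2 hxb
  have h := convexOn_exp.2 (Set.mem_univ (t * b)) (Set.mem_univ 0) ha0 (sub_nonneg.2 ha1)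
    (by ring)
  simp only [smul_eq_mul, mul_zero, add_zero, Real.exp_zero, mul_one] at h
  have hxe : x / b * (t * b) = t * x := by field_simp
  rw [hxe] at h
  have h2 := (abs_le.1 (Real.abs_exp_sub_one_sub_id_le ht)).2
  have h3 : x / b * (Real.exp (t * b) - 1) ≤ x / b * (t * b + (t * b) ^ 2) :=
    mul_le_mul_of_nonneg_left (by linarith) ha0
  have h4 : x / b * (t * b + (t * b) ^ 2) = (t + t ^ 2 * b) * x := by field_simp
  linarith

lemma integrable_exp_of_mem_Icc {P : Measure Ω} [IsFiniteMeasure P] {g : Ω → ℝ} {b : ℝ}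
    (hg : Measurable g) (h0 : ∀ x, 0 ≤ g x) (hgb : ∀ᵐ x ∂P, g x ≤ b) (t : ℝ) :
    Integrable (fun x => Real.exp (t * g x)) P := by
  refine Integrable.of_bound (by fun_prop) (Real.exp (|t| * b)) ?_
  filter_upwards [hgb] with x hx
  rw [Real.norm_eq_abs, Real.abs_exp, Real.exp_le_exp]
  exact (mul_le_mul_of_nonneg_right (le_abs_self t) (h0 x)).trans
    (mul_le_mul_of_nonneg_left hx (abs_nonneg t))

lemma integral_exp_mul_le {P : Measure Ω} [IsProbabilityMeasure P] {g : Ω → ℝ} {b : ℝ}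
    (hb : 0 < b) (hg : Measurable g) (h0 : ∀ x, 0 ≤ g x) (hgb : ∀ᵐ x ∂P, g x ≤ b) {t : ℝ}
    (ht : |t * b| ≤ 1) :
    ∫ x, Real.exp (t * g x) ∂P ≤ Real.exp ((∫ x, g x ∂P) * (t + t ^ 2 * b)) := by
  have hgi : Integrable g P := by
    refine Integrable.of_bound hg.aestronglyMeasurable b ?_
    filter_upwards [hgb] with x hx
    rwa [Real.norm_eq_abs, abs_of_nonneg (h0 x)]
  calc ∫ x, Real.exp (t * g x) ∂P ≤ ∫ x, (1 + (t + t ^ 2 * b) * g x) ∂P := by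
        refine integral_mono_ae (integrable_exp_of_mem_Icc hg h0 hgb t)
          ((integrable_const _).add (hgi.const_mul _)) ?_
        filter_upwards [hgb] with x hx
        exact exp_mul_le_chord hb (h0 x) hx ht
    _ = (∫ x, g x ∂P) * (t + t ^ 2 * b) + 1 := by
        rw [integral_add (integrable_const _) (hgi.const_mul _), integral_const_mul]
        simp only [integral_const, probReal_univ, one_smul]
        ring
    _ ≤ _ := Real.add_one_le_exp _

lemma hasBoundedSumMGF_pi {ι E : Type*} [Fintype ι] [MeasurableSpace E] (D : ι → Measure E)
    [∀ j, IsProbabilityMeasure (D j)] {g : E → ℝ} {b : ℝ} (hb : 0 < b) (hg : Measurable g)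
    (h0 : ∀ x, 0 ≤ g x) (hgb : ∀ j, ∀ᵐ x ∂(D j), g x ≤ b) :
    HasBoundedSumMGF (Measure.pi D) (fun S => ∑ j, g (S j)) b (∑ j, ∫ x, g x ∂(D j)) where
  integrable t := by
    have := Integrable.fintype_prod (f := fun _ x => Real.exp (t * g x)) (μ := D)
      fun j => integrable_exp_of_mem_Icc hg h0 (hgb j) t
    simpa only [Finset.mul_sum, Real.exp_sum] using this
  le t ht := by
    simp only [Finset.mul_sum, Finset.sum_mul, Real.exp_sum]
    rw [integral_fintype_prod_eq_prod (fun _ x => Real.exp (t * g x))]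
    exact Finset.prod_le_prod (fun j _ => integral_nonneg fun x => (Real.exp_pos _).le)
      fun j _ => integral_exp_mul_le hb hg h0 (hgb j) ht

/-- The range b stays that of a single term while the mean grows by s, so s samples multiply the
Chernoff exponent by s. -/
lemma HasBoundedSumMGF.pi_const {P : Measure Ω} [IsProbabilityMeasure P] {F : Ω → ℝ} {b M : ℝ}
    (h : HasBoundedSumMGF P F b M) (s : ℕ) :
    HasBoundedSumMGF (Measure.pi fun _ : Fin s => P) (fun S => ∑ l, F (S l)) b (s * M) where
  integrable t := by
    have := Integrable.fintype_prod (ι := Fin s) (f := fun _ x => Real.exp (t * F x))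
      (μ := fun _ => P) fun _ => h.integrable t
    simpa only [Finset.mul_sum, Real.exp_sum] using this
  le t ht := by
    simp only [Finset.mul_sum, Real.exp_sum]
    rw [integral_fintype_prod_eq_prod (fun _ x => Real.exp (t * F x)), Finset.prod_const,
      Finset.card_univ, Fintype.card_fin, mul_assoc, Real.exp_nat_mul]
    exact pow_le_pow_left₀ (integral_nonneg fun x => (Real.exp_pos _).le) (h.le t ht) s

lemma HasBoundedSumMGF.measure_le {P : Measure Ω} [IsProbabilityMeasure P] {F : Ω → ℝ} {b M : ℝ}
    (hb : 0 < b) (h : HasBoundedSumMGF P F b M) {a : ℝ} (ha0 : 0 < a) (ha1 : a ≤ 1) :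
    P.real {x | F x ≤ (1 - a) * M} ≤ Real.exp (-(a ^ 2 * M / (4 * b))) := by
  have htb : -(a / (2 * b)) * b = -(a / 2) := by field_simp
  have hneg : -(a / (2 * b)) ≤ 0 := neg_nonpos.2 (by positivity)
  refine (ProbabilityTheory.measure_le_le_exp_mul_mgf _ hneg (h.integrable _)).trans ?_
  refine (mul_le_mul_of_nonneg_left (h.le _ ?_) (Real.exp_pos _).le).trans ?_
  · rw [htb, abs_neg, abs_of_pos (by positivity)]
    linarith
  · rw [← Real.exp_add, Real.exp_le_exp]
    refine le_of_eq ?_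
    field_simp
    ring

/-- The deviation is measured against T because the mean M may be far below it. -/
lemma HasBoundedSumMGF.measure_ge {P : Measure Ω} [IsProbabilityMeasure P] {F : Ω → ℝ}
    {b M T : ℝ} (hb : 0 < b) (h : HasBoundedSumMGF P F b M) (hMT : M ≤ 2 * T) {a : ℝ}
    (ha0 : 0 < a) (ha1 : a ≤ 1) :
    P.real {x | M + a * T ≤ F x} ≤ Real.exp (-(a ^ 2 * T / (8 * b))) := by
  have htb : (a / (4 * b)) * b = a / 4 := by field_simp
  refine (ProbabilityTheory.measure_ge_le_exp_mul_mgf _ (t := a / (4 * b)) (by positivity)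
    (h.integrable _)).trans ?_
  refine (mul_le_mul_of_nonneg_left (h.le _ ?_) (Real.exp_pos _).le).trans ?_
  · rw [htb, abs_of_pos (by positivity)]
    linarith
  · rw [← Real.exp_add, Real.exp_le_exp]
    have h1 : -(a / (4 * b)) * (M + a * T) + M * (a / (4 * b) + (a / (4 * b)) ^ 2 * b)
        = a ^ 2 / (16 * b) * (M - 4 * T) := by
      field_simp
      ring
    have h2 : -(a ^ 2 * T / (8 * b)) = a ^ 2 / (16 * b) * (2 * T - 4 * T) := by
      field_simp
      ring
    rw [h1, h2]
    exact mul_le_mul_of_nonneg_left (by linarith) (by positivity)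

/-- Soft-max argument with t = e / b. The tangent inequality for exp at the level a = log m + K,
with m the number of variables, takes the place of Jensen. -/
lemma integral_iSup_le_of_mgf {ι : Type*} [Fintype ι] [Nonempty ι] {P : Measure Ω}
    [IsProbabilityMeasure P] {F : ι → Ω → ℝ} {b : ℝ} {M : ι → ℝ} {B e : ℝ} (hb : 0 < b)
    (hF : ∀ i, HasBoundedSumMGF P (F i) b (M i)) (hM : ∀ i, M i ≤ B)
    (hint : Integrable (fun x => ⨆ i, F i x) P) (he0 : 0 < e) (he1 : e ≤ 1) :
    ∫ x, ⨆ i, F i x ∂P ≤ (1 + e) * B + b * Real.log (Fintype.card ι) / e := by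
  have hcard : (0 : ℝ) < Fintype.card ι := by exact_mod_cast Fintype.card_pos
  set t := e / b with ht
  have ht0 : 0 < t := by positivity
  set K := B * (t + t ^ 2 * b) with hK
  set a := Real.log (Fintype.card ι) + K with ha
  have hmgf : ∀ i, ∫ x, Real.exp (t * F i x) ∂P ≤ Real.exp K := by
    intro i
    refine ((hF i).le t ?_).trans (Real.exp_le_exp.2 ?_)
    · rw [ht, div_mul_cancel₀ _ hb.ne', abs_of_pos he0]
      exact he1
    · exact mul_le_mul_of_nonneg_right (hM i) (by positivity)
  have hpt : ∀ x, t * (⨆ i, F i x) ≤ a - 1 + Real.exp (-a) * ∑ i, Real.exp (t * F i x) := by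
    intro x
    obtain ⟨i, hi⟩ := exists_eq_ciSup_of_finite (f := fun i => F i x)
    rw [← hi]
    have h1 := Real.add_one_le_exp (t * F i x - a)
    have h2 : Real.exp (t * F i x) ≤ ∑ i, Real.exp (t * F i x) :=
      Finset.single_le_sum (f := fun i => Real.exp (t * F i x))
        (fun i _ => (Real.exp_pos _).le) (Finset.mem_univ i)
    have h3 := mul_le_mul_of_nonneg_left h2 (Real.exp_pos (-a)).le
    rw [← Real.exp_add, neg_add_eq_sub] at h3
    linarith
  have hsumint : Integrable (fun x => ∑ i, Real.exp (t * F i x)) P :=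
    integrable_finsetSum _ fun i _ => (hF i).integrable t
  have hI : t * ∫ x, ⨆ i, F i x ∂P ≤ a := by
    rw [← integral_const_mul]
    calc ∫ x, t * ⨆ i, F i x ∂P
        ≤ ∫ x, (a - 1 + Real.exp (-a) * ∑ i, Real.exp (t * F i x)) ∂P :=
          integral_mono (hint.const_mul t) ((integrable_const _).add (hsumint.const_mul _)) hpt
      _ = a - 1 + Real.exp (-a) * ∑ i, ∫ x, Real.exp (t * F i x) ∂P := by
          rw [integral_add (integrable_const _) (hsumint.const_mul _), integral_const_mul,
            integral_finsetSum _ fun i _ => (hF i).integrable t]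
          simp
      _ ≤ a - 1 + Real.exp (-a) * ∑ _i : ι, Real.exp K := by
          have h := Finset.sum_le_sum fun i (_ : i ∈ Finset.univ) => hmgf i
          have := mul_le_mul_of_nonneg_left h (Real.exp_pos (-a)).le
          linarith
      _ = a := by
          have h1 : Real.exp (-a) * ∑ _i : ι, Real.exp K = 1 := by
            rw [Finset.sum_const, nsmul_eq_mul, Finset.card_univ, ha, neg_add, Real.exp_add,
              Real.exp_neg, Real.exp_log hcard, Real.exp_neg]
            field_simp
          linarith
  have hfin : (1 + e) * B + b * Real.log (Fintype.card ι) / e = a / t := by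
    rw [ha, hK, ht]
    field_simp
    ring
  rw [hfin, le_div_iff₀ ht0]
  linarith

/-- A measurable minimiser of finitely many measurable functions. -/
lemma exists_measurable_argmin {κ α : Type*} [MeasurableSpace α] (K : Finset κ)
    (hK : K.Nonempty) (a : κ → α) {f : κ → Ω → ℝ} (hf : ∀ k, Measurable (f k)) :
    ∃ A : Ω → α, Measurable A ∧ ∀ x, ∃ k ∈ K, A x = a k ∧ ∀ k' ∈ K, f k x ≤ f k' x := by
  classical
  suffices H : ∃ (A : Ω → α) (h : Ω → ℝ), Measurable A ∧ Measurable h ∧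
      ∀ x, ∃ k ∈ K, A x = a k ∧ h x = f k x ∧ ∀ k' ∈ K, f k x ≤ f k' x by
    obtain ⟨A, h, hA, -, H⟩ := H
    refine ⟨A, hA, fun x => ?_⟩
    obtain ⟨k, hk, h1, -, h2⟩ := H x
    exact ⟨k, hk, h1, h2⟩
  induction hK using Finset.Nonempty.cons_induction with
  | singleton k => exact ⟨fun _ => a k, f k, measurable_const, hf k, fun x => ⟨k, by simp⟩⟩
  | cons k K hk hK ih =>
    obtain ⟨A, h, hA, hh, H⟩ := ih
    have hset : MeasurableSet {x | f k x ≤ h x} := measurableSet_le (hf k) hh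
    refine ⟨fun x => if f k x ≤ h x then a k else A x, fun x => if f k x ≤ h x then f k x else h x,
      Measurable.ite hset measurable_const hA, Measurable.ite hset (hf k) hh, fun x => ?_⟩
    obtain ⟨k₁, hk₁, hA₁, hh₁, hmin⟩ := H x
    by_cases hx : f k x ≤ h x
    · refine ⟨k, Finset.mem_cons_self k K, if_pos hx, if_pos hx, fun k' hk' => ?_⟩
      rcases Finset.mem_cons.1 hk' with rfl | hk'
      · exact le_rfl
      · exact (hx.trans hh₁.le).trans (hmin k' hk')
    · refine ⟨k₁, Finset.mem_cons_of_mem hk₁, (if_neg hx).trans hA₁, (if_neg hx).trans hh₁,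
        fun k' hk' => ?_⟩
      rcases Finset.mem_cons.1 hk' with rfl | hk'
      · rw [← hh₁]
        exact (not_le.1 hx).le
      · exact hmin k' hk'

end Tails

/-! ### Hall's condition for the optimum, and mean loads of random instances -/

section Jobs

variable {m n : ℕ}

lemma share_nonneg {w : Fin m → ℝ} (hw : ∀ i, 0 < w i) (i : Fin m) (N : Finset (Fin m)) :
    0 ≤ share w i N := by
  unfold share
  split_ifs
  · exact div_nonneg (hw i).le (Finset.sum_nonneg fun l _ => (hw l).le)
  · exact le_rfl

lemma share_le_one {w : Fin m → ℝ} (hw : ∀ i, 0 < w i) (i : Fin m) (N : Finset (Fin m)) :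
    share w i N ≤ 1 := by
  unfold share
  split_ifs with h
  · exact div_le_one_of_le₀ (Finset.single_le_sum (fun l _ => (hw l).le) h)
      (Finset.sum_nonneg fun l _ => (hw l).le)
  · exact zero_le_one

/-- The load that a job puts on machine `i` under the weights `w`. -/
def jobLoad (w : Fin m → ℝ) (i : Fin m) (J : Job m) : ℝ := J.size * share w i J.nbhd

lemma alg_eq (S : JobInstance m n) (w : Fin m → ℝ) : alg S w = ⨆ i, ∑ j, jobLoad w i (S j) := rfl

lemma Job.measurable_size : Measurable (Job.size : Job m → ℝ) :=
  Measurable.of_comap_le le_sup_left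

lemma Job.measurable_comp_nbhd (f : Finset (Fin m) → ℝ) :
    Measurable fun J : Job m => f J.nbhd := by
  have h : @Measurable _ _ (Job.instMeasurableSpace m) ⊤ (Job.nbhd : Job m → Finset (Fin m)) :=
    Measurable.of_comap_le le_sup_right
  exact (@measurable_from_top _ _ _ f).comp h

lemma measurable_jobLoad (w : Fin m → ℝ) (i : Fin m) : Measurable (jobLoad w i) :=
  Job.measurable_size.mul (Job.measurable_comp_nbhd _)

lemma jobLoad_nonneg {w : Fin m → ℝ} (hw : ∀ i, 0 < w i) (i : Fin m) (J : Job m) :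
    0 ≤ jobLoad w i J := mul_nonneg J.size_pos.le (share_nonneg hw i _)

lemma jobLoad_le_size {w : Fin m → ℝ} (hw : ∀ i, 0 < w i) (i : Fin m) (J : Job m) :
    jobLoad w i J ≤ J.size := mul_le_of_le_one_right J.size_pos.le (share_le_one hw i _)

lemma isFractionalAssignment_propAssign (S : JobInstance m n) {w : Fin m → ℝ}
    (hw : ∀ i, 0 < w i) : IsFractionalAssignment S (propAssign S w) where
  nonneg i j := share_nonneg hw i _
  support i j hi := if_neg hi
  sum_eq_one j := by
    have hpos : 0 < ∑ i ∈ (S j).nbhd, w i := Finset.sum_pos (fun i _ => hw i) (S j).nbhd_nonempty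
    simp only [propAssign]
    rw [← Finset.sum_filter, Finset.filter_mem_eq_inter, Finset.univ_inter, ← Finset.sum_div,
      div_self hpos.ne']

lemma load_nonneg {S : JobInstance m n} {x : Fin m → Fin n → ℝ} (hx : IsFractionalAssignment S x)
    (i : Fin m) : 0 ≤ load S x i :=
  Finset.sum_nonneg fun j _ => mul_nonneg (S j).size_pos.le (hx.nonneg i j)

lemma load_le_makespan (S : JobInstance m n) (x : Fin m → Fin n → ℝ) (i : Fin m) :
    load S x i ≤ makespan S x := le_ciSup (Set.finite_range _).bddAbove i

lemma opt_le_alg (S : JobInstance m n) {w : Fin m → ℝ} (hw : ∀ i, 0 < w i) :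
    opt S ≤ alg S w := by
  refine csInf_le ⟨0, ?_⟩ ⟨_, isFractionalAssignment_propAssign S hw, rfl⟩
  rintro _ ⟨x, hx, rfl⟩
  exact Real.iSup_nonneg (load_nonneg hx)

/-- The jobs that are confined to the machines in `A` need total time at most `|A| * opt S`. -/
lemma sum_size_le_card_mul_opt (S : JobInstance m n) (A : Finset (Fin m)) :
    ∑ j, (S j).size * (if (S j).nbhd ⊆ A then 1 else 0) ≤ A.card * opt S := by
  have hle : ∀ x, IsFractionalAssignment S x →
      ∑ j, (S j).size * (if (S j).nbhd ⊆ A then 1 else 0) ≤ A.card * makespan S x := by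
    intro x hx
    calc ∑ j, (S j).size * (if (S j).nbhd ⊆ A then (1 : ℝ) else 0)
        ≤ ∑ j, (S j).size * ∑ i ∈ A, x i j := by
          refine Finset.sum_le_sum fun j _ => mul_le_mul_of_nonneg_left ?_ (S j).size_pos.le
          split_ifs with h
          · rw [← hx.sum_eq_one j]
            refine (Finset.sum_subset (Finset.subset_univ A) fun i _ hi => ?_).symm.le
            exact hx.support i j fun hmem => hi (h hmem)
          · exact Finset.sum_nonneg fun i _ => hx.nonneg i j
      _ = ∑ i ∈ A, load S x i := by
          simp only [load, Finset.mul_sum]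
          exact Finset.sum_comm
      _ ≤ A.card • makespan S x := Finset.sum_le_card_nsmul _ _ _ fun i _ => load_le_makespan S x i
      _ = A.card * makespan S x := nsmul_eq_mul _ _
  rcases A.eq_empty_or_nonempty with rfl | hA
  · simpa using hle _ (isFractionalAssignment_propAssign S (w := 1) fun _ => zero_lt_one)
  · have hc : (0 : ℝ) < A.card := by exact_mod_cast hA.card_pos
    rw [← div_le_iff₀' hc]
    refine le_csInf ⟨_, _, isFractionalAssignment_propAssign S (w := 1) fun _ => zero_lt_one,
      rfl⟩ ?_
    rintro _ ⟨x, hx, rfl⟩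
    rw [div_le_iff₀' hc]
    exact hle x hx

lemma alg_eq_opt_of_eq_one (hm : m = 1) (S : JobInstance m n) {w : Fin m → ℝ}
    (hw : ∀ i, 0 < w i) : alg S w = opt S := by
  subst hm
  refine le_antisymm ?_ (opt_le_alg S hw)
  rw [alg_eq]
  refine ciSup_le fun i => (Finset.sum_le_sum fun j _ => jobLoad_le_size hw i (S j)).trans ?_
  have h := sum_size_le_card_mul_opt S Finset.univ
  simpa only [Finset.subset_univ, if_true, mul_one, Finset.card_univ, Fintype.card_fin,
    Nat.cast_one, one_mul] using h

variable (D : Fin n → Measure (Job m)) [∀ j, IsProbabilityMeasure (D j)]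

/-- The expected load of machine `i` under the weights `w`. -/
def meanLoad (D : Fin n → Measure (Job m)) (w : Fin m → ℝ) (i : Fin m) : ℝ :=
  ∑ j, ∫ J, jobLoad w i J ∂(D j)

/-- The expected total size of the jobs with neighbourhood `N`. -/
def meanVolume (D : Fin n → Measure (Job m)) (N : Finset (Fin m)) : ℝ :=
  ∑ j, ∫ J, J.size * (if J.nbhd = N then 1 else 0) ∂(D j)

lemma meanVolume_nonneg (D : Fin n → Measure (Job m)) (N : Finset (Fin m)) :
    0 ≤ meanVolume D N :=
  Finset.sum_nonneg fun j _ => integral_nonneg fun J =>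
    mul_nonneg J.size_pos.le (by split_ifs <;> simp)

variable {D} {pmax : ℝ}

lemma integrable_size_mul (hD : ∀ j, ∀ᵐ J ∂(D j), J.size ≤ pmax) (j : Fin n)
    (f : Finset (Fin m) → ℝ) : Integrable (fun J => J.size * f J.nbhd) (D j) := by
  have hsize : Integrable (fun J : Job m => J.size) (D j) := by
    refine Integrable.of_bound Job.measurable_size.aestronglyMeasurable pmax ?_
    filter_upwards [hD j] with J hJ
    rwa [Real.norm_eq_abs, abs_of_pos J.size_pos]
  refine hsize.mul_bdd (c := ∑ N, |f N|) (Job.measurable_comp_nbhd f).aestronglyMeasurable ?_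
  exact Filter.Eventually.of_forall fun J =>
    Finset.single_le_sum (f := fun N => |f N|) (fun N _ => abs_nonneg _) (Finset.mem_univ J.nbhd)

lemma sum_meanVolume_mul (hD : ∀ j, ∀ᵐ J ∂(D j), J.size ≤ pmax) (f : Finset (Fin m) → ℝ) :
    ∑ N, meanVolume D N * f N = ∑ j, ∫ J, J.size * f J.nbhd ∂(D j) := by
  simp only [meanVolume, Finset.sum_mul]
  rw [Finset.sum_comm]
  refine Finset.sum_congr rfl fun j _ => ?_
  simp only [← integral_mul_const]
  rw [← integral_finsetSum _ fun N _ => (integrable_size_mul hD j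
    fun N' => if N' = N then 1 else 0).mul_const (f N)]
  congr 1
  funext J
  simp

/-- Hall's condition is linear in the job sizes, so it survives taking expectations. -/
lemma sum_meanVolume_le (hD : ∀ j, ∀ᵐ J ∂(D j), J.size ≤ pmax)
    (hopt : Integrable opt (Measure.pi D)) (A : Finset (Fin m)) :
    ∑ N ∈ A.powerset, meanVolume D N ≤ A.card * ∫ S, opt S ∂(Measure.pi D) := by
  have h1 : ∑ N ∈ A.powerset, meanVolume D N
      = ∑ N, meanVolume D N * (if N ⊆ A then (1 : ℝ) else 0) := by
    simp only [mul_ite, mul_one, mul_zero]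
    rw [← Finset.sum_filter]
    congr 1
    ext
    simp
  have hint : ∀ j, Integrable (fun S : JobInstance m n =>
      (S j).size * (if (S j).nbhd ⊆ A then (1 : ℝ) else 0)) (Measure.pi D) := fun j =>
    (measurePreserving_eval D j).integrable_comp_of_integrable
      (integrable_size_mul hD j fun N => if N ⊆ A then 1 else 0)
  have h2 : ∀ j, ∫ J, J.size * (if J.nbhd ⊆ A then (1 : ℝ) else 0) ∂(D j)
      = ∫ S : JobInstance m n,
        (S j).size * (if (S j).nbhd ⊆ A then (1 : ℝ) else 0) ∂(Measure.pi D) := fun j =>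
    (integral_comp_eval (μ := D) (i := j) (integrable_size_mul hD j
      fun N => if N ⊆ A then (1 : ℝ) else 0).aestronglyMeasurable).symm
  rw [h1, sum_meanVolume_mul hD fun N => if N ⊆ A then (1 : ℝ) else 0]
  simp only [h2]
  rw [← integral_finsetSum _ fun j _ => hint j, ← integral_const_mul]
  exact integral_mono (integrable_finsetSum _ fun j _ => hint j) (hopt.const_mul _)
    fun S => sum_size_le_card_mul_opt S A

lemma exists_grid_weights_meanLoad_le (hD : ∀ j, ∀ᵐ J ∂(D j), J.size ≤ pmax)
    (hopt : Integrable opt (Measure.pi D)) {ε : ℝ} (hε : 0 < ε) {G : ℕ}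
    (hG : m ≤ ε / 16 * (1 + ε) ^ G) :
    ∃ k : Fin m → ℕ, (∀ i, k i ≤ m * G) ∧ ∀ i,
      meanLoad D (fun l => (1 + ε) ^ k l) i ≤ (1 + 9 / 16 * ε) * ∫ S, opt S ∂(Measure.pi D) := by
  obtain ⟨k, hk, h⟩ := exists_grid_weights_load_le (meanVolume_nonneg D) hε
    (sum_meanVolume_le hD hopt) hG
  refine ⟨k, hk, fun i => le_trans (le_of_eq ?_) (h i)⟩
  rw [sum_meanVolume_mul hD]
  rfl

lemma hasBoundedSumMGF_load (hp : 0 < pmax) (hD : ∀ j, ∀ᵐ J ∂(D j), J.size ≤ pmax)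
    {w : Fin m → ℝ} (hw : ∀ i, 0 < w i) (i : Fin m) :
    HasBoundedSumMGF (Measure.pi D) (fun S => ∑ j, jobLoad w i (S j)) pmax (meanLoad D w i) :=
  hasBoundedSumMGF_pi D hp (measurable_jobLoad w i) (jobLoad_nonneg hw i) fun j => by
    filter_upwards [hD j] with J hJ using (jobLoad_le_size hw i J).trans hJ

lemma measurable_load (w : Fin m → ℝ) (i : Fin m) :
    Measurable fun S : JobInstance m n => ∑ j, jobLoad w i (S j) :=
  Finset.measurable_sum _ fun j _ => (measurable_jobLoad w i).comp (measurable_pi_apply j)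

lemma integrable_alg (hm : 0 < m) (hD : ∀ j, ∀ᵐ J ∂(D j), J.size ≤ pmax) {w : Fin m → ℝ}
    (hw : ∀ i, 0 < w i) : Integrable (fun S => alg S w) (Measure.pi D) := by
  have : Nonempty (Fin m) := ⟨⟨0, hm⟩⟩
  refine Integrable.of_bound (C := ∑ _j : Fin n, pmax)
    (Measurable.iSup fun i => measurable_load w i).aestronglyMeasurable ?_
  have hall : ∀ᵐ S ∂(Measure.pi D), ∀ j, (S j).size ≤ pmax := by
    rw [ae_all_iff]
    exact fun j => (measurePreserving_eval D j).quasiMeasurePreserving.ae (hD j)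
  filter_upwards [hall] with S hS
  rw [Real.norm_eq_abs, alg_eq, abs_of_nonneg
    (Real.iSup_nonneg fun i => Finset.sum_nonneg fun j _ => jobLoad_nonneg hw i (S j))]
  exact ciSup_le fun i => Finset.sum_le_sum fun j _ => (jobLoad_le_size hw i (S j)).trans (hS j)

end Jobs

/-! ### Grid size and union bound -/

section Numerics

lemma half_le_log_two : (1 / 2 : ℝ) ≤ Real.log 2 := by
  have := Real.log_two_gt_d9
  linarith

variable {m : ℕ} {ε : ℝ}

lemma two_le_div (hm : 2 ≤ m) (hε : 0 < ε) (hε1 : ε < 1) : (2 : ℝ) ≤ m / ε := by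
  have : (2 : ℝ) ≤ m := by exact_mod_cast hm
  rw [le_div_iff₀ hε]
  linarith

lemma log_two_le_log_div (hm : 2 ≤ m) (hε : 0 < ε) (hε1 : ε < 1) :
    Real.log 2 ≤ Real.log (m / ε) :=
  Real.log_le_log two_pos (two_le_div hm hε hε1)

lemma exists_block_length (hm : 2 ≤ m) (hε : 0 < ε) (hε1 : ε < 1) :
    ∃ G : ℕ, (m : ℝ) ≤ ε / 16 * (1 + ε) ^ G ∧ m * G ≤ roundBound 12 m ε := by
  have hX := two_le_div hm hε hε1
  have hlog := log_two_le_log_div hm hε hε1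
  have hlog2 := half_le_log_two
  have hm0 : (0 : ℝ) < m := by positivity
  set X := (m : ℝ) / ε with hXdef
  have hlog16 : Real.log (16 * X) = 4 * Real.log 2 + Real.log X := by
    rw [Real.log_mul (by norm_num) (by positivity), show (16 : ℝ) = 2 ^ 4 by norm_num,
      Real.log_pow]
    norm_num
  have hlog16pos : 0 ≤ Real.log (16 * X) := by linarith
  refine ⟨⌈2 / ε * Real.log (16 * X)⌉₊, ?_, ?_⟩
  · have h1 := Nat.le_ceil (2 / ε * Real.log (16 * X))
    set G := ⌈2 / ε * Real.log (16 * X)⌉₊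
    have h2 : ε / 2 ≤ Real.log (1 + ε) := by
      refine le_trans ?_ (Real.le_log_one_add_of_nonneg hε.le)
      rw [le_div_iff₀ (by positivity)]
      nlinarith
    have h3 : Real.log (16 * X) ≤ G * Real.log (1 + ε) := by
      calc Real.log (16 * X) = 2 / ε * Real.log (16 * X) * (ε / 2) := by field_simp
        _ ≤ G * Real.log (1 + ε) := mul_le_mul h1 h2 (by positivity) (by positivity)
    have h4 : 16 * X ≤ (1 + ε) ^ G := by
      rw [← Real.log_pow] at h3
      exact (Real.log_le_log_iff (by positivity) (by positivity)).1 h3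
    calc (m : ℝ) = ε / 16 * (16 * X) := by
          rw [hXdef]
          field_simp
      _ ≤ _ := mul_le_mul_of_nonneg_left h4 (by positivity)
  · have h1 := (Nat.ceil_lt_add_one (a := 2 / ε * Real.log (16 * X)) (by positivity)).le
    -- Since X ≥ 2, log(16X) ≤ 5 log X gives 10, and rounding up costs at most 2 more.
    have h2 : 2 / ε * Real.log (16 * X) + 1 ≤ 12 * (Real.log X / ε) := by
      have h3 : 2 / ε * Real.log (16 * X) ≤ 2 / ε * (5 * Real.log X) :=
        mul_le_mul_of_nonneg_left (by linarith) (by positivity)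
      have h4 : 1 ≤ 2 * (Real.log X / ε) := by
        rw [← mul_div_assoc, le_div_iff₀ hε]
        linarith
      have h5 : 2 / ε * (5 * Real.log X) = 10 * (Real.log X / ε) := by ring
      linarith
    have h6 : (m : ℝ) * (12 * (Real.log X / ε)) ≤ 12 * ((m : ℝ) ^ 2 / ε ^ 2 * Real.log X) := by
      have h7 : (m : ℝ) ^ 2 / ε ^ 2 * Real.log X = X * (m * (Real.log X / ε)) := by
        rw [hXdef]
        field_simp
      have h8 : 0 ≤ (m : ℝ) * (Real.log X / ε) :=
        mul_nonneg hm0.le (div_nonneg (by linarith) hε.le)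
      rw [h7]
      nlinarith
    have h9 := Nat.le_ceil (12 * ((m : ℝ) ^ 2 / ε ^ 2 * Real.log X))
    have h10 : (m : ℝ) * (⌈2 / ε * Real.log (16 * X)⌉₊ : ℝ) ≤ (roundBound 12 m ε : ℝ) :=
      (mul_le_mul_of_nonneg_left (h1.trans h2) hm0.le).trans (h6.trans h9)
    exact_mod_cast h10

lemma roundBound_add_one_le (hm : 2 ≤ m) (hε : 0 < ε) (hε1 : ε < 1) :
    (roundBound 12 m ε : ℝ) + 1 ≤ (m / ε) ^ 7 := by
  have hX := two_le_div hm hε hε1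
  have hlog := log_two_le_log_div hm hε hε1
  have hlog2 := half_le_log_two
  unfold roundBound
  rw [← div_pow]
  set X := (m : ℝ) / ε
  have hlogX : Real.log X ≤ X := Real.log_le_self (by linarith)
  have h1 := (Nat.ceil_lt_add_one (a := 12 * (X ^ 2 * Real.log X)) (by
    have : 0 ≤ Real.log X := by linarith
    positivity)).le
  have h2 : X ^ 2 * Real.log X ≤ X ^ 2 * X := mul_le_mul_of_nonneg_left hlogX (by positivity)
  have h3 : (2 : ℝ) ^ 3 ≤ X ^ 3 := pow_le_pow_left₀ (by norm_num) hX 3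
  have h4 : (2 : ℝ) ^ 4 ≤ X ^ 4 := pow_le_pow_left₀ (by norm_num) hX 4
  have h5 : X ^ 7 = X ^ 4 * X ^ 3 := by ring
  have h6 : X ^ 2 * X = X ^ 3 := by ring
  nlinarith

/-- There are at most 2(m/ε)^(7m+1) bad events, so of the sample bound only its consequence s ≥ 64 m
log(2/δ) log(m/ε) is needed. -/
lemma union_bound_le {δ : ℝ} {s : ℕ} (hm : 2 ≤ m) (hε : 0 < ε) (hε1 : ε < 1) (hδ : 0 < δ)
    (hδ1 : δ < 1)
    (hs : 64 * ((m : ℝ) ^ 3 / ε ^ 2 * Real.log (2 / δ) * Real.log (m / ε)) ≤ (s : ℝ)) :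
    (((roundBound 12 m ε : ℝ) + 1) ^ m * m + m) * Real.exp (-(s * Real.log (m / ε))) ≤ δ := by
  have hX := two_le_div hm hε hε1
  have hlog := log_two_le_log_div hm hε hε1
  have hlog2 := half_le_log_two
  have hR := roundBound_add_one_le hm hε hε1
  have hm2 : (2 : ℝ) ≤ m := by exact_mod_cast hm
  have hL : Real.log 2 ≤ Real.log (2 / δ) := by
    refine Real.log_le_log two_pos ?_
    rw [le_div_iff₀ hδ]
    linarith
  have hmX : (m : ℝ) ≤ m / ε := by
    rw [le_div_iff₀ hε]
    nlinarith
  have hm3 : (m : ℝ) ≤ (m : ℝ) ^ 3 / ε ^ 2 := by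
    rw [le_div_iff₀ (by positivity)]
    have h1 : ε ^ 2 ≤ 1 := by nlinarith
    have h2 : (1 : ℝ) ≤ m ^ 2 := by nlinarith
    have h3 : (m : ℝ) ^ 3 = m * m ^ 2 := by ring
    rw [h3]
    exact mul_le_mul_of_nonneg_left (h1.trans h2) (by linarith)
  set X := (m : ℝ) / ε
  set l := Real.log X with hl
  set L := Real.log (2 / δ) with hLdef
  have hs' : 64 * (m * (L * l)) ≤ (s : ℝ) := by
    refine le_trans ?_ hs
    rw [mul_assoc ((m : ℝ) ^ 3 / ε ^ 2)]
    have : 0 ≤ L * l := mul_nonneg (by linarith) (by linarith)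
    nlinarith
  have hexp : (7 * m + 1) * l + L ≤ s * l := by
    have h1 : 0 ≤ (L - 1 / 2) * (l - 1 / 2) := mul_nonneg (by linarith) (by linarith)
    have h2 : 16 * (m : ℝ) ≤ s := by nlinarith
    have h3 : L * 1 ≤ L * (m * l) := mul_le_mul_of_nonneg_left (by nlinarith) (by linarith)
    have h4 : 64 * L ≤ (s : ℝ) := by nlinarith
    nlinarith
  have hcount : ((roundBound 12 m ε : ℝ) + 1) ^ m * m + m ≤ 2 * X ^ (7 * m + 1) := by
    have h1 : ((roundBound 12 m ε : ℝ) + 1) ^ m ≤ (X ^ 7) ^ m :=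
      pow_le_pow_left₀ (by positivity) hR m
    rw [← pow_mul] at h1
    have h2 : (1 : ℝ) ≤ X ^ (7 * m) := one_le_pow₀ (by linarith)
    have h3 : ((roundBound 12 m ε : ℝ) + 1) ^ m * m ≤ X ^ (7 * m) * X :=
      mul_le_mul h1 hmX (by linarith) (by positivity)
    rw [pow_succ]
    nlinarith
  have hX0 : 0 < X := by linarith
  calc _ ≤ 2 * X ^ (7 * m + 1) * Real.exp (-(s * l)) :=
        mul_le_mul_of_nonneg_right hcount (Real.exp_pos _).le
    _ = 2 * Real.exp ((7 * m + 1) * l - s * l) := by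
        rw [sub_eq_add_neg, Real.exp_add]
        have h1 : X ^ (7 * m + 1) = Real.exp ((7 * m + 1) * l) := by
          rw [← Real.exp_log (pow_pos hX0 (7 * m + 1)), Real.log_pow]
          push_cast
          rfl
        rw [h1]
        ring
    _ ≤ 2 * Real.exp (-L) :=
        mul_le_mul_of_nonneg_left (Real.exp_le_exp.2 (by linarith)) two_pos.le
    _ = δ := by
        rw [hLdef, Real.exp_neg, Real.exp_log (by positivity)]
        field_simp

end Numerics

/-! ### Analysis of the learner -/

section Learning

variable {m n : ℕ} {ε : ℝ}

/-- The grid weights with exponents `k`. -/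
def gridWeights {R : ℕ} (ε : ℝ) (k : Fin m → Fin (R + 1)) (i : Fin m) : ℝ := (1 + ε) ^ (k i : ℕ)

lemma gridWeights_pos {R : ℕ} (hε : 0 < ε) (k : Fin m → Fin (R + 1)) (i : Fin m) :
    0 < gridWeights ε k i := by
  unfold gridWeights
  positivity

lemma gridWeights_mem {R : ℕ} (k : Fin m → Fin (R + 1)) :
    gridWeights ε k ∈ weightGrid m ε R :=
  fun i => ⟨k i, Nat.lt_succ_iff.1 (k i).2, rfl⟩

lemma pos_of_mem_weightGrid {R : ℕ} (hε : 0 < ε) {w : Fin m → ℝ} (hw : w ∈ weightGrid m ε R)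
    (i : Fin m) : 0 < w i := by
  obtain ⟨k, -, h⟩ := hw i
  rw [h]
  positivity

/-- The total load of machine `i` over all samples. -/
def sampleLoad {s : ℕ} (w : Fin m → ℝ) (i : Fin m) (samples : Fin s → JobInstance m n) : ℝ :=
  ∑ l, ∑ j, jobLoad w i (samples l j)

lemma measurable_sampleLoad {s : ℕ} (w : Fin m → ℝ) (i : Fin m) :
    Measurable (sampleLoad w i : (Fin s → JobInstance m n) → ℝ) :=
  Finset.measurable_sum _ fun l _ => (measurable_load w i).comp (measurable_pi_apply l)

lemma expected_alg_le_mul_expected_alg {D : Fin n → Measure (Job m)}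
    [∀ j, IsProbabilityMeasure (D j)] {pmax : ℝ} (hm : 0 < m)
    (hD : ∀ j, ∀ᵐ J ∂(D j), J.size ≤ pmax) (hopt : Integrable opt (Measure.pi D)) (hε : 0 < ε)
    {w w' : Fin m → ℝ} (hw' : ∀ i, 0 < w' i)
    (h : ∫ S, alg S w ∂(Measure.pi D) ≤ (1 + ε) * ∫ S, opt S ∂(Measure.pi D)) :
    ∫ S, alg S w ∂(Measure.pi D) ≤ (1 + ε) * ∫ S, alg S w' ∂(Measure.pi D) :=
  h.trans (mul_le_mul_of_nonneg_left
    (integral_mono hopt (integrable_alg hm hD hw') fun S => opt_le_alg S hw') (by positivity))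

/-- With e = ε/16, the lower bound on T turns the additive term of the expected maximum into at most
εT/128. -/
lemma expected_alg_le_of_meanLoad_le {D : Fin n → Measure (Job m)}
    [∀ j, IsProbabilityMeasure (D j)] {pmax T : ℝ} (hm : 0 < m) (hε : 0 < ε) (hε1 : ε < 1)
    (hp : 0 < pmax) (hD : ∀ j, ∀ᵐ J ∂(D j), J.size ≤ pmax) (hT : 0 ≤ T)
    (hpT : 2048 * (pmax * (1 / ε ^ 2 * Real.log (m / ε))) ≤ T) {w : Fin m → ℝ}
    (hw : ∀ i, 0 < w i) (hmean : ∀ i, meanLoad D w i ≤ (1 + 12 * (ε / 16)) * T) :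
    ∫ S, alg S w ∂(Measure.pi D) ≤ (1 + ε) * T := by
  have : Nonempty (Fin m) := ⟨⟨0, hm⟩⟩
  have hm1 : (1 : ℝ) ≤ m := by exact_mod_cast hm
  have h := integral_iSup_le_of_mgf hp (fun i => hasBoundedSumMGF_load hp hD hw i) hmean
    (integrable_alg hm hD hw) (e := ε / 16) (by positivity) (by linarith)
  rw [Fintype.card_fin] at h
  have hlog : Real.log m ≤ Real.log (m / ε) := by
    refine Real.log_le_log (by linarith) ?_
    rw [le_div_iff₀ hε]
    nlinarith
  have h1 : pmax * Real.log m / (ε / 16) ≤ T * (ε / 128) := by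
    calc pmax * Real.log m / (ε / 16) ≤ pmax * Real.log (m / ε) / (ε / 16) := by gcongr
      _ = 2048 * (pmax * (1 / ε ^ 2 * Real.log (m / ε))) * (ε / 128) := by
          field_simp
          ring
      _ ≤ T * (ε / 128) := mul_le_mul_of_nonneg_right hpT (by positivity)
  have h2 : (1 + ε / 16) * ((1 + 12 * (ε / 16)) * T) + T * (ε / 128) ≤ (1 + ε) * T := by
    have h3 : (1 + ε / 16) * (1 + 12 * (ε / 16)) + ε / 128 ≤ 1 + ε := by nlinarith
    nlinarith
  exact (h.trans (by linarith) : ∫ S, alg S w ∂(Measure.pi D)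
    ≤ (1 + ε / 16) * ((1 + 12 * (ε / 16)) * T) + T * (ε / 128)).trans h2

/-- Outside the deviation events, minimising the largest sample load nearly minimises the largest
mean load. -/
lemma meanLoad_le_of_sampleLoad_le {D : Fin n → Measure (Job m)} {s : ℕ} (hs : 0 < s) {T : ℝ}
    (hT : 0 ≤ T) (hε : 0 < ε) (hε1 : ε < 1) {w w₀ : Fin m → ℝ}
    {samples : Fin s → JobInstance m n}
    (hlow : ∀ i, T ≤ meanLoad D w i →
      (1 - ε / 16) * (s * meanLoad D w i) < sampleLoad w i samples)
    (hup : ∀ i, sampleLoad w₀ i samples < s * meanLoad D w₀ i + ε / 16 * (s * T))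
    (hmean : ∀ i, meanLoad D w₀ i ≤ (1 + 9 / 16 * ε) * T)
    (hmin : ⨆ i, sampleLoad w i samples ≤ ⨆ i, sampleLoad w₀ i samples) (i : Fin m) :
    meanLoad D w i ≤ (1 + 12 * (ε / 16)) * T := by
  have hs0 : (0 : ℝ) < s := by exact_mod_cast hs
  have : Nonempty (Fin m) := ⟨i⟩
  by_contra! hlt
  have hTM : T ≤ meanLoad D w i := by nlinarith
  have h1 : sampleLoad w i samples ≤ ⨆ i, sampleLoad w i samples :=
    le_ciSup (f := fun i => sampleLoad w i samples) (Set.finite_range _).bddAbove i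
  have h2 : ⨆ i, sampleLoad w₀ i samples ≤ s * ((1 + 10 * (ε / 16)) * T) := by
    refine ciSup_le fun l => (hup l).le.trans ?_
    have := mul_le_mul_of_nonneg_left (hmean l) hs0.le
    linarith
  have h3 : s * ((1 - ε / 16) * meanLoad D w i) < s * ((1 + 10 * (ε / 16)) * T) := by
    have := hlow i hTM
    linarith
  have h4 := lt_of_mul_lt_mul_left h3 hs0.le
  have h5 : (1 - ε / 16) * ((1 + 12 * (ε / 16)) * T) < (1 - ε / 16) * meanLoad D w i :=
    mul_lt_mul_of_pos_left hlt (by linarith)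
  -- In units of ε/16: 9 for the comparator, 10 after its upper deviation, and 12 after dividing by
  -- 1 - ε/16.
  have h6 : 1 + 10 * (ε / 16) ≤ (1 - ε / 16) * (1 + 12 * (ε / 16)) := by nlinarith
  nlinarith

/-- Subadditivity holds for arbitrary sets, so neither the good set nor the bad events need to be
measurable. -/
lemma one_sub_le_measureReal_of_compl {Ω κ : Type*} [MeasurableSpace Ω] (Q : Measure Ω)
    [IsProbabilityMeasure Q] (K : Finset κ) (B : κ → Set Ω) {E : Set Ω}
    (h : ∀ x, (∀ k ∈ K, x ∉ B k) → x ∈ E) {η : ℝ} (hB : ∀ k ∈ K, Q.real (B k) ≤ η) :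
    1 - K.card * η ≤ Q.real E := by
  have hcover : Set.univ ⊆ E ∪ ⋃ k ∈ K, B k := by
    intro x _
    by_cases hx : ∀ k ∈ K, x ∉ B k
    · exact Or.inl (h x hx)
    · push Not at hx
      obtain ⟨k, hk, hxk⟩ := hx
      exact Or.inr (Set.mem_biUnion hk hxk)
  have h1 := (measureReal_mono hcover (μ := Q)).trans (measureReal_union_le _ _)
  have h2 := measureReal_biUnion_finset_le (μ := Q) K B
  have h3 := Finset.sum_le_card_nsmul K _ _ hB
  rw [nsmul_eq_mul] at h3
  rw [probReal_univ] at h1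
  linarith

theorem one_sub_le_measureReal_learned {s : ℕ} {δ : ℝ} (hm : 2 ≤ m) (hε : 0 < ε) (hε1 : ε < 1)
    (hδ : 0 < δ) (hδ1 : δ < 1)
    (hs : 64 * ((m : ℝ) ^ 3 / ε ^ 2 * Real.log (2 / δ) * Real.log (m / ε)) ≤ (s : ℝ))
    {A : (Fin s → JobInstance m n) → Fin m → ℝ}
    (hA : ∀ samples, ∃ k : Fin m → Fin (roundBound 12 m ε + 1), A samples = gridWeights ε k ∧
      ∀ k' : Fin m → Fin (roundBound 12 m ε + 1),
        ⨆ i, sampleLoad (gridWeights ε k) i samples ≤ ⨆ i, sampleLoad (gridWeights ε k') i samples)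
    {D : Fin n → Measure (Job m)} [∀ j, IsProbabilityMeasure (D j)] {pmax : ℝ} (hp : 0 < pmax)
    (hD : ∀ j, ∀ᵐ J ∂(D j), J.size ≤ pmax) (hopt : Integrable opt (Measure.pi D))
    (hpT : 2048 * (pmax * (1 / ε ^ 2 * Real.log (m / ε))) ≤ ∫ S, opt S ∂(Measure.pi D)) :
    1 - δ ≤ (Measure.pi (fun _ : Fin s => Measure.pi D)).real
      {samples | ∫ S, alg S (A samples) ∂(Measure.pi D)
        ≤ (1 + ε) * ∫ S, opt S ∂(Measure.pi D)} := by
  classical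
  have hm0 : 0 < m := by omega
  have hlog := log_two_le_log_div hm hε hε1
  have hlog2 := half_le_log_two
  have hunion := union_bound_le hm hε hε1 hδ hδ1 hs
  set R := roundBound 12 m ε
  set T := ∫ S, opt S ∂(Measure.pi D) with hTdef
  have hlogpos : 0 < Real.log (m / ε) := by linarith
  have hTpos : 0 < T := lt_of_lt_of_le (by positivity) hpT
  have hLpos : 0 < Real.log (2 / δ) := by
    refine Real.log_pos ?_
    rw [lt_div_iff₀ hδ]
    linarith
  have hs0 : 0 < s := by
    have : (0 : ℝ) < s := lt_of_lt_of_le (by positivity) hs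
    exact_mod_cast this
  obtain ⟨G, hG, hGR⟩ := exists_block_length hm hε hε1
  obtain ⟨k₀', hk₀', hmean'⟩ := exists_grid_weights_meanLoad_le hD hopt hε hG
  set k₀ : Fin m → Fin (R + 1) := fun i => ⟨k₀' i, Nat.lt_succ_of_le ((hk₀' i).trans hGR)⟩
  have hmean : ∀ i, meanLoad D (gridWeights ε k₀) i ≤ (1 + 9 / 16 * ε) * T := hmean'
  set Q := Measure.pi (fun _ : Fin s => Measure.pi D)
  -- The constant 2048 is 8 · 16²: accuracy ε/16 in the upper tail bound.
  have hexp : s * Real.log (m / ε) ≤ (ε / 16) ^ 2 * (s * T) / (8 * pmax) := by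
    rw [le_div_iff₀ (by positivity)]
    calc s * Real.log (m / ε) * (8 * pmax)
        = (ε / 16) ^ 2 * (s * (2048 * (pmax * (1 / ε ^ 2 * Real.log (m / ε))))) := by
          field_simp
          norm_num
      _ ≤ _ := by gcongr
  -- Underestimates must be excluded for every grid weight with a mean load of at least T,
  -- overestimates only for the one comparator `k₀`.
  set B : ((Fin m → Fin (R + 1)) × Fin m) ⊕ Fin m → Set (Fin s → JobInstance m n) :=
    Sum.elim
      (fun p => {samples | T ≤ meanLoad D (gridWeights ε p.1) p.2 ∧
        sampleLoad (gridWeights ε p.1) p.2 samples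
          ≤ (1 - ε / 16) * (s * meanLoad D (gridWeights ε p.1) p.2)})
      (fun i => {samples | s * meanLoad D (gridWeights ε k₀) i + ε / 16 * (s * T)
        ≤ sampleLoad (gridWeights ε k₀) i samples}) with hBdef
  have hmgf : ∀ (k : Fin m → Fin (R + 1)) (i : Fin m), HasBoundedSumMGF Q
      (sampleLoad (gridWeights ε k) i) pmax (s * meanLoad D (gridWeights ε k) i) := fun k i =>
    (hasBoundedSumMGF_load hp hD (gridWeights_pos hε k) i).pi_const s
  have hB : ∀ p ∈ (Finset.univ : Finset (((Fin m → Fin (R + 1)) × Fin m) ⊕ Fin m)),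
      Q.real (B p) ≤ Real.exp (-(s * Real.log (m / ε))) := by
    rintro (⟨k, i⟩ | i) -
    · by_cases hTM : T ≤ meanLoad D (gridWeights ε k) i
      · refine (measureReal_mono fun x hx => hx.2).trans
          (((hmgf k i).measure_le hp (a := ε / 16) (by positivity) (by linarith)).trans ?_)
        rw [Real.exp_le_exp, neg_le_neg_iff]
        refine hexp.trans ?_
        have hM := hTpos.trans_le hTM
        gcongr
        norm_num
      · have : B (Sum.inl (k, i)) = ∅ := by
          ext x
          simp [hBdef, hTM]
        rw [this, measureReal_empty]
        positivity
    · refine ((hmgf k₀ i).measure_ge hp (T := s * T) ?_ (a := ε / 16) (by positivity)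
        (by linarith)).trans ?_
      · have h1 : meanLoad D (gridWeights ε k₀) i ≤ 2 * T := by nlinarith [hmean i]
        have := mul_le_mul_of_nonneg_left h1 (Nat.cast_nonneg (α := ℝ) s)
        linarith
      · rw [Real.exp_le_exp, neg_le_neg_iff]
        exact hexp
  have hgood : ∀ x, (∀ p ∈ (Finset.univ : Finset (((Fin m → Fin (R + 1)) × Fin m) ⊕ Fin m)),
      x ∉ B p) → x ∈ {samples | ∫ S, alg S (A samples) ∂(Measure.pi D) ≤ (1 + ε) * T} := by
    intro x hx
    obtain ⟨k, hAk, hmin⟩ := hA x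
    rw [Set.mem_ofPred_eq, hAk]
    refine expected_alg_le_of_meanLoad_le hm0 hε hε1 hp hD hTpos.le hpT (gridWeights_pos hε k) ?_
    refine meanLoad_le_of_sampleLoad_le hs0 hTpos.le hε hε1 (fun i hTM => ?_) (fun i => ?_) hmean
      (hmin k₀)
    · by_contra! hcon
      exact hx (Sum.inl (k, i)) (Finset.mem_univ _) ⟨hTM, hcon⟩
    · by_contra! hcon
      exact hx (Sum.inr i) (Finset.mem_univ _) hcon
  refine le_trans ?_ (one_sub_le_measureReal_of_compl Q _ B hgood hB)
  have hcard : ((Finset.univ : Finset (((Fin m → Fin (R + 1)) × Fin m) ⊕ Fin m)).card : ℝ)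
      = ((R : ℝ) + 1) ^ m * m + m := by
    simp
  rw [hcard]
  linarith

end Learning

end

/-! ### The theorem -/

theorem theorem6 :
    ∃ C₀ C₁ C₂ : ℝ, 0 < C₀ ∧ 0 < C₁ ∧ 0 < C₂ ∧
      ∀ (m n : ℕ) (ε δ : ℝ), 0 < m → 0 < ε → ε < 1 → 0 < δ → δ < 1 →
      ∀ s : ℕ,
        C₂ * ((m : ℝ) ^ 3 / ε ^ 2 * Real.log (2 / δ) * Real.log (m / ε)) ≤ (s : ℝ) →
      ∃ A : (Fin s → JobInstance m n) → (Fin m → ℝ),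
        Measurable A ∧
        (∀ samples, A samples ∈ weightGrid m ε (roundBound C₁ m ε)) ∧
        ∀ (D : Fin n → Measure (Job m)) [∀ j, IsProbabilityMeasure (D j)] (pmax : ℝ),
          0 < pmax →
          (∀ j, ∀ᵐ J ∂(D j), J.size ≤ pmax) →
          C₀ * (pmax * (1 / ε ^ 2 * Real.log (m / ε))) ≤ ∫ S, opt S ∂(Measure.pi D) →
          1 - δ ≤ (Measure.pi (fun _ : Fin s => Measure.pi D)).real
            {samples |
              Integrable (fun S => alg S (A samples)) (Measure.pi D) ∧
              ∫ S, alg S (A samples) ∂(Measure.pi D)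
                ≤ (1 + ε) * ∫ S, opt S ∂(Measure.pi D) ∧
              ∀ w' ∈ weightGrid m ε (roundBound C₁ m ε),
                ∫ S, alg S (A samples) ∂(Measure.pi D)
                  ≤ (1 + ε) * ∫ S, alg S w' ∂(Measure.pi D)} := by
  refine ⟨2048, 12, 64, by norm_num, by norm_num, by norm_num, ?_⟩
  intro m n ε δ hm hε hε1 hδ hδ1 s hs
  have : Nonempty (Fin m) := ⟨⟨0, hm⟩⟩
  obtain ⟨A, hAmeas, hA⟩ := exists_measurable_argmin
    (Finset.univ : Finset (Fin m → Fin (roundBound 12 m ε + 1))) Finset.univ_nonempty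
    (gridWeights ε)
    (f := fun k (samples : Fin s → JobInstance m n) => ⨆ i, sampleLoad (gridWeights ε k) i samples)
    fun k => Measurable.iSup fun i => measurable_sampleLoad _ i
  have hAmem : ∀ samples, A samples ∈ weightGrid m ε (roundBound 12 m ε) := by
    intro samples
    obtain ⟨k, -, hk, -⟩ := hA samples
    rw [hk]
    exact gridWeights_mem k
  refine ⟨A, hAmeas, hAmem, fun D _ pmax hp hD hpT => ?_⟩
  have hlogpos : 0 < Real.log (m / ε) := by
    have hm1 : (1 : ℝ) ≤ m := by exact_mod_cast hm
    refine Real.log_pos ?_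
    rw [lt_div_iff₀ hε]
    linarith
  have hTpos : 0 < ∫ S, opt S ∂(Measure.pi D) := lt_of_lt_of_le (by positivity) hpT
  -- A nonintegrable function has Bochner integral 0, so positivity of the integral forces
  -- integrability.
  have hopt : Integrable opt (Measure.pi D) := by
    by_contra hcon
    rw [integral_undef hcon] at hTpos
    exact lt_irrefl _ hTpos
  have hApos : ∀ samples i, 0 < A samples i := fun samples =>
    pos_of_mem_weightGrid hε (hAmem samples)
  have hlearn : 1 - δ ≤ (Measure.pi (fun _ : Fin s => Measure.pi D)).real
      {samples | ∫ S, alg S (A samples) ∂(Measure.pi D)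
        ≤ (1 + ε) * ∫ S, opt S ∂(Measure.pi D)} := by
    -- For m = 1 the logarithm log(m/ε) may be close to 0 and the union bound fails, but every
    -- assignment is then optimal.
    rcases Nat.lt_or_ge 1 m with hm2 | hm1
    · refine one_sub_le_measureReal_learned hm2 hε hε1 hδ hδ1 hs (fun samples => ?_) hp hD hopt hpT
      obtain ⟨k, -, hk, hmin⟩ := hA samples
      exact ⟨k, hk, fun k' => hmin k' (Finset.mem_univ k')⟩
    · have huniv : {samples : Fin s → JobInstance m n | ∫ S, alg S (A samples) ∂(Measure.pi D)
          ≤ (1 + ε) * ∫ S, opt S ∂(Measure.pi D)} = Set.univ := by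
        refine Set.eq_univ_of_forall fun samples => ?_
        simp only [Set.mem_ofPred_eq, alg_eq_opt_of_eq_one (le_antisymm hm1 hm) _ (hApos samples)]
        nlinarith
      rw [huniv, probReal_univ]
      linarith
  refine hlearn.trans (measureReal_mono fun samples h => ?_)
  exact ⟨integrable_alg hm hD (hApos samples), h, fun w' hw' =>
    expected_alg_le_mul_expected_alg hm hD hopt hε (pos_of_mem_weightGrid hε hw') h⟩
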